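/- **Definitions.** All intervals are of the form $Q=[a,b)$ with $a<b$, and $|\cdot|$ is Lebesgue measure on $\mathbb{R}$. For an interval $Q_0=[a,b)$ let $\mathcal{D}(Q_0)$ be the set of its dyadic subintervals, i.e. of the intervals $\left[a+\tfrac{i(b-a)}{2^{j}},\,a+\tfrac{(i+1)(b-a)}{2^{j}}\right)$ with integers $j\ge 0$ and $0\le i<2^j$. Let $E\subset\mathbb{R}$. A set $Q$ is $E$-free if $Q\cap E=\emptyset$. For $\delta\ge 0$ let $\mathcal{S}_\delta(Q_0)$ be the family of all inclusion-maximal members of $\{Q\in\mathcal{D}(Q_0): Q\ E\text{-free},\ |Q|\ge\delta\}$. Put $$\mathcal{V}_1(Q_0)=\sup\{|Q|:Q\in\mathcal{D}(Q_0),\ Q\cap E=\emptyset\},$$ $$\mathcal{V}_t(Q_0)=\sup\Big\{\delta>0:\sum_{Q\in\mathcal{S}_\delta(Q_0)}|Q|\ge(1-t)|Q_0|\Big\}\quad(0<t<1),$$ where the supremum of the empty set is $0$. * $E$ is *weakly porous* if there are $0<s,\delta<1$ such that $\sum_{Q\in\mathcal{S}_{\delta\mathcal{V}_1(Q_0)}(Q_0)}|Q|\ge(1-s)|Q_0|$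 for every interval $Q_0$ that intersects $E$. * $E$ is *median porous* if there are $0<s<t<1$ and $0<\delta<1$ such that $\sum_{Q\in\mathcal{S}_{\delta\mathcal{V}_t(Q_0)}(Q_0)}|Q|\ge(1-s)|Q_0|$ for every interval $Q_0$ that intersects $E$. For a locally integrable function $f$ on $\mathbb{R}$ let $\langle f\rangle_Q=\frac1{|Q|}\int_Q f\,dx$. Then $f\in BMO$ if $\sup_Q\frac1{|Q|}\int_Q|f-\langle f\rangle_Q|\,dx<\infty$, and $f\in BLO$ if $\sup_Q\big[\langle f\rangle_Q-\operatorname{ess\,inf}_Q f\big]<\infty$, where the suprema are over all intervals $Q$. Functions that agree almost everywhere are identified. **Theorem.** Let $0<\gamma<1$ and $E_\gamma=\{\pm m^\gamma: m=1,2,3,\dots\}\subset\mathbb{R}$. Then $E_\gamma$ is median porous but not weakly porous. Moreover $-\log\operatorname{dist}(\cdot,E_\gamma)\in BMO\setminus BLO$ (in particular this function is locally integrable). -/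

import Mathlib

open MeasureTheory Set
open scoped ENNReal

/-- The dyadic subcubes `𝒟(Q₀)` of the one-dimensional cube `Q₀ = [a, b)`: for every `j`, the
`2 ^ j` disjoint half-open intervals of length `2 ^ (-j) * (b - a)` that partition `[a, b)`. -/
def dyadicSubintervals (a b : ℝ) : Set (Set ℝ) :=
  {Q | ∃ j i : ℕ, i < 2 ^ j ∧
    Q = Ico (a + i * ((b - a) / 2 ^ j)) (a + (i + 1) * ((b - a) / 2 ^ j))}

/-- `Q` is an `E`-free dyadic subcube of `[a, b)` of measure at least `δ`. -/
def IsFreeDyadic (E : Set ℝ) (a b : ℝ) (δ : ℝ≥0∞) (Q : Set ℝ) : Prop :=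
  Q ∈ dyadicSubintervals a b ∧ Q ∩ E = ∅ ∧ δ ≤ volume Q

/-- `𝒮_δ(Q₀)` for `Q₀ = [a, b)`: the maximal (with respect to inclusion) members of the family of
`E`-free dyadic subcubes of `Q₀` of measure at least `δ`. -/
def maximalFree (E : Set ℝ) (a b : ℝ) (δ : ℝ≥0∞) : Set (Set ℝ) :=
  {Q | Maximal (IsFreeDyadic E a b δ) Q}

/-- The total measure `∑_{Q ∈ 𝒮_δ(Q₀)} |Q|`. -/
noncomputable def freeMass (E : Set ℝ) (a b : ℝ) (δ : ℝ≥0∞) : ℝ≥0∞ :=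
  ∑' Q : maximalFree E a b δ, volume (Q : Set ℝ)

/-- `𝒱_s(Q₀)` for `0 < s < 1`: the supremum of all `δ > 0` such that the `E`-free dyadic subcubes
of measure at least `δ` fill a proportion at least `1 - s` of `Q₀ = [a, b)`. -/
noncomputable def medianHole (E : Set ℝ) (s a b : ℝ) : ℝ≥0∞ :=
  sSup {δ : ℝ≥0∞ | 0 < δ ∧ ENNReal.ofReal (1 - s) * volume (Ico a b) ≤ freeMass E a b δ}

/-- `𝒱₁(Q₀)`: the largest measure of an `E`-free dyadic subcube of `Q₀ = [a, b)`. -/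
noncomputable def maximalHole (E : Set ℝ) (a b : ℝ) : ℝ≥0∞ :=
  sSup {v : ℝ≥0∞ | ∃ Q ∈ dyadicSubintervals a b, Q ∩ E = ∅ ∧ v = volume Q}

/-- Weakly porous subsets of the real line. -/
def IsWeaklyPorous (E : Set ℝ) : Prop :=
  ∃ s δ : ℝ, 0 < s ∧ s < 1 ∧ 0 < δ ∧ δ < 1 ∧
    ∀ a b : ℝ, a < b → (Ico a b ∩ E).Nonempty →
      ENNReal.ofReal (1 - s) * volume (Ico a b) ≤
        freeMass E a b (ENNReal.ofReal δ * maximalHole E a b)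

/-- Median porous subsets of the real line. -/
def IsMedianPorous (E : Set ℝ) : Prop :=
  ∃ s t δ : ℝ, 0 < s ∧ s < t ∧ t < 1 ∧ 0 < δ ∧ δ < 1 ∧
    ∀ a b : ℝ, a < b → (Ico a b ∩ E).Nonempty →
      ENNReal.ofReal (1 - s) * volume (Ico a b) ≤
        freeMass E a b (ENNReal.ofReal δ * medianHole E t a b)

/-- Functions of bounded mean oscillation on the real line. -/
def IsBMO (f : ℝ → ℝ) : Prop :=
  LocallyIntegrable f volume ∧
    ∃ C : ℝ, ∀ a b : ℝ, a < b → ⨍ x in Ico a b, |f x - ⨍ y in Ico a b, f y| ≤ C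

/-- Functions of bounded lower oscillation on the real line. The essential infimum is taken in
`EReal`, so that it is `-∞` (and the difference is `+∞`) if `f` is not essentially bounded below
on the interval. -/
def IsBLO (f : ℝ → ℝ) : Prop :=
  LocallyIntegrable f volume ∧
    ∃ C : ℝ, ∀ a b : ℝ, a < b →
      ((⨍ x in Ico a b, f x : ℝ) : EReal)
        - essInf (fun x => (f x : EReal)) (volume.restrict (Ico a b)) ≤ (C : EReal)

/-- The set `E_γ = {± m ^ γ : m = 1, 2, 3, …}`. -/
def gammaPowers (γ : ℝ) : Set ℝ :=
  {x | ∃ m : ℕ, 1 ≤ m ∧ (x = (m : ℝ) ^ γ ∨ x = -(m : ℝ) ^ γ)}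

/-! Put p = 1/γ - 1 > 0. Consecutive points of E near x ≠ 0 are about |x|^(-p) apart, by concavity
of t^γ, so E looks locally like a lattice whose mesh shrinks as |x| grows. Two estimates carry
everything: a gap around x has length at most 2|x|^(-p) (`exists_gammaPowers_bracket`), and an
interval of length ℓ inside [-R, R] contains at most 2(ℓR^p/γ + 1) points
(`exists_finset_gammaPowers_inter_Icc`).

Weak porosity fails on [0, 2^k): the single hole [0, 1) keeps the maximal hole at least 1, while
free intervals of length at least δ stay within a bounded distance of the origin. The median hole
ignores such an exceptional hole. With M = max(|a|, |b|), more than half of [a, b) lies at |x| >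
M/16, so the median hole is at most a multiple of min(b - a, M^(-p)); the point count shows that
free intervals of a comparable length fill most of [a, b).

For f = -log dist(·, E), compare f with -log L at a scale L adapted to the interval. Where the
distance is below L, f is dominated by logarithmic singularities at about (b - a)/L points, each of
integral 2L. Where it is above L, the gap bound gives a majorant of integral O(b - a). BLO fails on
[0, 2X): f is bounded on [0, 1/2], while its average grows like log X. -/

section DyadicSubintervals

/-! ### Dyadic intervals and the mass of the maximal free ones. -/

theorem countable_dyadicSubintervals (a b : ℝ) : (dyadicSubintervals a b).Countable := by
  have h : dyadicSubintervals a b ⊆ range (fun q : ℕ × ℕ =>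
      Ico (a + q.2 * ((b - a) / 2 ^ q.1)) (a + (q.2 + 1) * ((b - a) / 2 ^ q.1))) := by
    rintro Q ⟨j, i, -, rfl⟩
    exact ⟨(j, i), rfl⟩
  exact (countable_range _).mono h

theorem measurableSet_of_mem_dyadicSubintervals {a b : ℝ} {Q : Set ℝ}
    (hQ : Q ∈ dyadicSubintervals a b) : MeasurableSet Q := by
  obtain ⟨j, i, -, rfl⟩ := hQ
  exact measurableSet_Ico

theorem dyadic_length_pos {a b : ℝ} (hab : a < b) (j : ℕ) : 0 < (b - a) / 2 ^ j :=
  div_pos (sub_pos.2 hab) (by positivity)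

theorem volume_dyadic (a b : ℝ) (j i : ℕ) :
    volume (Ico (a + i * ((b - a) / 2 ^ j)) (a + (i + 1) * ((b - a) / 2 ^ j))) =
      ENNReal.ofReal ((b - a) / 2 ^ j) := by
  rw [Real.volume_Ico]
  congr 1
  ring

theorem subset_Ico_of_mem_dyadicSubintervals {a b : ℝ} (hab : a < b) {Q : Set ℝ}
    (hQ : Q ∈ dyadicSubintervals a b) : Q ⊆ Ico a b := by
  obtain ⟨j, i, hi, rfl⟩ := hQ
  have hl := dyadic_length_pos hab j
  apply Ico_subset_Ico
  · have : (0 : ℝ) ≤ i * ((b - a) / 2 ^ j) := by positivity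
    linarith
  · have h1 : ((i : ℝ) + 1) ≤ 2 ^ j := by exact_mod_cast hi
    have h2 : ((i : ℝ) + 1) * ((b - a) / 2 ^ j) ≤ 2 ^ j * ((b - a) / 2 ^ j) := by gcongr
    rw [mul_div_cancel₀ _ (by positivity)] at h2
    linarith

/-- A dyadic interval that meets another one of at least the same generation is contained in it. -/
theorem dyadic_subset_of_le {a b : ℝ} (hab : a < b) {j i j' i' : ℕ} (hj : j ≤ j') {x : ℝ}
    (hx : x ∈ Ico (a + i * ((b - a) / 2 ^ j)) (a + (i + 1) * ((b - a) / 2 ^ j)))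
    (hx' : x ∈ Ico (a + i' * ((b - a) / 2 ^ j')) (a + (i' + 1) * ((b - a) / 2 ^ j'))) :
    Ico (a + i' * ((b - a) / 2 ^ j')) (a + (i' + 1) * ((b - a) / 2 ^ j')) ⊆
      Ico (a + i * ((b - a) / 2 ^ j)) (a + (i + 1) * ((b - a) / 2 ^ j)) := by
  obtain ⟨k, rfl⟩ := Nat.exists_eq_add_of_le hj
  have hl := dyadic_length_pos hab (j + k)
  have hlen : (b - a) / 2 ^ j = 2 ^ k * ((b - a) / 2 ^ (j + k)) := by
    rw [pow_add]; field_simp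
  rw [hlen] at hx ⊢
  set l := (b - a) / 2 ^ (j + k) with hl_def
  obtain ⟨h1, h2⟩ := hx
  obtain ⟨h3, h4⟩ := hx'
  have h5 : i * 2 ^ k < i' + 1 := by
    have : ((i : ℝ) * 2 ^ k) * l < (i' + 1) * l := by linarith
    exact_mod_cast lt_of_mul_lt_mul_right this hl.le
  have h6 : i' < (i + 1) * 2 ^ k := by
    have : (i' : ℝ) * l < ((i + 1) * 2 ^ k) * l := by linarith
    exact_mod_cast lt_of_mul_lt_mul_right this hl.le
  have h7 : (i : ℝ) * 2 ^ k ≤ i' := by exact_mod_cast Nat.lt_succ_iff.1 h5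
  have h8 : (i' : ℝ) + 1 ≤ (i + 1) * 2 ^ k := by exact_mod_cast h6
  apply Ico_subset_Ico
  · have := mul_le_mul_of_nonneg_right h7 hl.le
    linarith
  · have := mul_le_mul_of_nonneg_right h8 hl.le
    linarith

theorem subset_or_subset_of_mem_dyadicSubintervals {a b : ℝ} (hab : a < b) {Q Q' : Set ℝ}
    (hQ : Q ∈ dyadicSubintervals a b) (hQ' : Q' ∈ dyadicSubintervals a b)
    (h : (Q ∩ Q').Nonempty) : Q ⊆ Q' ∨ Q' ⊆ Q := by
  obtain ⟨x, hx, hx'⟩ := h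
  obtain ⟨j, i, -, rfl⟩ := hQ
  obtain ⟨j', i', -, rfl⟩ := hQ'
  rcases le_total j j' with hj | hj
  · exact Or.inr (dyadic_subset_of_le hab hj hx hx')
  · exact Or.inl (dyadic_subset_of_le hab hj hx' hx)

/-- A larger dyadic interval has generation at most j. Hence a free interval always lies in a
maximal one, whatever δ is. -/
theorem finite_dyadic_supersets {a b : ℝ} (hab : a < b) {Q : Set ℝ}
    (hQ : Q ∈ dyadicSubintervals a b) :
    {Q' | Q' ∈ dyadicSubintervals a b ∧ Q ⊆ Q'}.Finite := by
  obtain ⟨j, i, -, rfl⟩ := hQ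
  refine ((finite_Iic j).biUnion fun k _ => (finite_Iio (2 ^ k)).image fun m : ℕ =>
    Ico (a + m * ((b - a) / 2 ^ k)) (a + (m + 1) * ((b - a) / 2 ^ k))).subset ?_
  rintro Q' ⟨⟨k, m, hm, rfl⟩, hsub⟩
  have hv := measure_mono (μ := volume) hsub
  rw [volume_dyadic, volume_dyadic, ENNReal.ofReal_le_ofReal_iff (dyadic_length_pos hab k).le,
    div_le_div_iff_of_pos_left (sub_pos.2 hab) (by positivity) (by positivity),
    pow_le_pow_iff_right₀ (by norm_num)] at hv
  simp only [mem_iUnion]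
  exact ⟨k, hv, m, hm, rfl⟩

theorem exists_maximalFree_superset {E : Set ℝ} {a b : ℝ} (hab : a < b) {δ : ℝ≥0∞} {Q : Set ℝ}
    (hQ : IsFreeDyadic E a b δ Q) : ∃ Q' ∈ maximalFree E a b δ, Q ⊆ Q' := by
  have hfin : {Q' | IsFreeDyadic E a b δ Q' ∧ Q ⊆ Q'}.Finite :=
    (finite_dyadic_supersets hab hQ.1).subset fun Q' h => ⟨h.1.1, h.2⟩
  obtain ⟨Q', hQQ', hmax⟩ := hfin.exists_le_maximal ⟨hQ, Subset.rfl⟩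
  refine ⟨Q', ⟨hmax.prop.1, fun R hR hle => ?_⟩, hQQ'⟩
  exact hmax.le_of_ge ⟨hR, hQQ'.trans hle⟩ hle

theorem countable_maximalFree (E : Set ℝ) (a b : ℝ) (δ : ℝ≥0∞) :
    (maximalFree E a b δ).Countable :=
  (countable_dyadicSubintervals a b).mono fun _ h => h.prop.1

/-- Maximal dyadic intervals are disjoint, by nestedness, so the sum is the measure of one set and
can be bounded by inclusions. -/
theorem freeMass_eq_volume_sUnion {E : Set ℝ} {a b : ℝ} (hab : a < b) (δ : ℝ≥0∞) :
    freeMass E a b δ = volume (⋃₀ maximalFree E a b δ) := by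
  rw [freeMass, measure_sUnion (countable_maximalFree E a b δ)]
  · intro Q hQ Q' hQ' hne
    by_contra hd
    rw [not_disjoint_iff_nonempty_inter] at hd
    rcases subset_or_subset_of_mem_dyadicSubintervals hab hQ.prop.1 hQ'.prop.1 hd with h | h
    · exact hne (hQ.eq_of_le hQ'.prop h)
    · exact hne (hQ'.eq_of_le hQ.prop h).symm
  · exact fun Q hQ => measurableSet_of_mem_dyadicSubintervals hQ.prop.1

theorem freeMass_le_of_subset {E : Set ℝ} {a b : ℝ} (hab : a < b) {δ : ℝ≥0∞} {S : Set ℝ}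
    (h : ∀ Q, IsFreeDyadic E a b δ Q → Q ⊆ S) : freeMass E a b δ ≤ volume S := by
  rw [freeMass_eq_volume_sUnion hab]
  exact measure_mono (sUnion_subset fun Q hQ => h Q hQ.prop)

theorem exists_dyadic_mem {a b : ℝ} (hab : a < b) (j : ℕ) {x : ℝ} (hx : x ∈ Ico a b) :
    ∃ i : ℕ, i < 2 ^ j ∧
      x ∈ Ico (a + i * ((b - a) / 2 ^ j)) (a + (i + 1) * ((b - a) / 2 ^ j)) := by
  have hl := dyadic_length_pos hab j
  have h0 : 0 ≤ (x - a) / ((b - a) / 2 ^ j) := div_nonneg (sub_nonneg.2 hx.1) hl.le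
  have h1 := Nat.floor_le h0
  have h2 := Nat.lt_floor_add_one ((x - a) / ((b - a) / 2 ^ j))
  rw [le_div_iff₀ hl] at h1
  rw [div_lt_iff₀ hl] at h2
  refine ⟨⌊(x - a) / ((b - a) / 2 ^ j)⌋₊, ?_, by linarith, by linarith⟩
  rw [Nat.floor_lt h0, div_lt_iff₀ hl]
  push_cast
  rw [mul_div_cancel₀ _ (by positivity)]
  linarith [hx.2]

/-- The free dyadic intervals of generation `j` miss at most the `ℓ`-neighbourhood of
`E ∩ [a, b)`, where `ℓ` is their length. -/
theorem volume_le_freeMass_add {E : Set ℝ} {a b : ℝ} (hab : a < b) {δ : ℝ≥0∞} {j : ℕ}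
    (hδ : δ ≤ ENNReal.ofReal ((b - a) / 2 ^ j)) {F : Finset ℝ} (hF : E ∩ Ico a b ⊆ F) :
    volume (Ico a b) ≤
      freeMass E a b δ + ENNReal.ofReal (2 * ((b - a) / 2 ^ j) * F.card) := by
  have hl := dyadic_length_pos hab j
  set l := (b - a) / 2 ^ j with hl_def
  have hsub : Ico a b ⊆ ⋃₀ maximalFree E a b δ ∪ ⋃ e ∈ F, Ioo (e - l) (e + l) := by
    intro x hx
    obtain ⟨i, hi, hxi⟩ := exists_dyadic_mem hab j hx
    by_cases hE : Ico (a + i * ((b - a) / 2 ^ j)) (a + (i + 1) * ((b - a) / 2 ^ j)) ∩ E = ∅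
    · left
      obtain ⟨Q', hQ', hs⟩ := exists_maximalFree_superset (E := E) (δ := δ) hab
        ⟨⟨j, i, hi, rfl⟩, hE, by rw [volume_dyadic]; exact hδ⟩
      exact ⟨Q', hQ', hs hxi⟩
    · right
      obtain ⟨e, heI, heE⟩ := nonempty_iff_ne_empty.2 hE
      have heF : e ∈ F := hF
        ⟨heE, subset_Ico_of_mem_dyadicSubintervals hab ⟨j, i, hi, rfl⟩ heI⟩
      simp only [mem_iUnion]
      rw [← hl_def] at hxi heI
      exact ⟨e, heF, by linarith [hxi.1, heI.2], by linarith [hxi.2, heI.1]⟩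
  calc volume (Ico a b)
      ≤ volume (⋃₀ maximalFree E a b δ) + volume (⋃ e ∈ F, Ioo (e - l) (e + l)) :=
        (measure_mono hsub).trans (measure_union_le _ _)
    _ ≤ freeMass E a b δ + ∑ e ∈ F, volume (Ioo (e - l) (e + l)) := by
        rw [freeMass_eq_volume_sUnion hab]
        gcongr
        exact measure_biUnion_finset_le _ _
    _ = freeMass E a b δ + ENNReal.ofReal (2 * l * F.card) := by
        congr 1
        rw [Finset.sum_congr rfl (g := fun _ => ENNReal.ofReal (2 * l)) fun e _ => by
          rw [Real.volume_Ioo]; congr 1; ring]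
        rw [Finset.sum_const, nsmul_eq_mul, ENNReal.ofReal_mul (by positivity : 0 ≤ 2 * l),
          ENNReal.ofReal_natCast, mul_comm]

end DyadicSubintervals

/-! ### Gap lengths and point counts of E_γ. -/

section GammaPowers

/-- Concavity of t^γ. It bounds gaps from above with (x, y) = (m + 1, m), and from below with x = m,
y = n. -/
theorem rpow_le_tangent {γ : ℝ} (hγ0 : 0 ≤ γ) (hγ1 : γ ≤ 1) {x y : ℝ} (hx : 0 ≤ x) (hy : 0 < y) :
    x ^ γ ≤ y ^ γ + γ * y ^ (γ - 1) * (x - y) := by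
  have h := rpow_one_add_le_one_add_mul_self (s := x / y - 1)
    (by linarith [div_nonneg hx hy.le]) hγ0 hγ1
  rw [add_sub_cancel, Real.div_rpow hx hy.le, div_le_iff₀ (Real.rpow_pos_of_pos hy γ)] at h
  refine h.trans_eq ?_
  rw [Real.rpow_sub_one hy.ne']
  field_simp

theorem neg_mem_gammaPowers {γ x : ℝ} (hx : x ∈ gammaPowers γ) : -x ∈ gammaPowers γ := by
  obtain ⟨m, hm, rfl | rfl⟩ := hx
  · exact ⟨m, hm, Or.inr rfl⟩
  · exact ⟨m, hm, Or.inl (neg_neg _)⟩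

theorem one_mem_gammaPowers (γ : ℝ) : (1 : ℝ) ∈ gammaPowers γ :=
  ⟨1, le_rfl, Or.inl (by simp)⟩

theorem countable_gammaPowers (γ : ℝ) : (gammaPowers γ).Countable := by
  have h : gammaPowers γ ⊆
      range (fun m : ℕ => (m : ℝ) ^ γ) ∪ range (fun m : ℕ => -(m : ℝ) ^ γ) := by
    rintro x ⟨m, -, rfl | rfl⟩
    · exact Or.inl ⟨m, rfl⟩
    · exact Or.inr ⟨m, rfl⟩
  exact ((countable_range _).union (countable_range _)).mono h

theorem exists_gammaPowers_bracket_of_one_le {γ : ℝ} (hγ0 : 0 < γ) (hγ1 : γ < 1) {x : ℝ}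
    (hx : 1 ≤ x) : ∃ u ∈ gammaPowers γ, ∃ v ∈ gammaPowers γ, u ≤ x ∧ x ≤ v ∧
      v - u ≤ 2 ∧ v - u ≤ 2 * x ^ (-(1 / γ - 1)) := by
  have hx0 : 0 < x := by linarith
  have hy1 : 1 ≤ x ^ (1 / γ) := Real.one_le_rpow hx (by positivity)
  set y := x ^ (1 / γ) with hy
  have hyx : y ^ γ = x := by rw [hy, ← Real.rpow_mul hx0.le]; field_simp; simp
  have hm1 : 1 ≤ ⌊y⌋₊ := Nat.one_le_floor_iff _ |>.2 hy1
  have hmy : (⌊y⌋₊ : ℝ) ≤ y := Nat.floor_le (by linarith)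
  have hym : y < ⌊y⌋₊ + 1 := Nat.lt_floor_add_one y
  set m := ⌊y⌋₊
  have hmR : (1 : ℝ) ≤ m := by exact_mod_cast hm1
  have hm0 : (0 : ℝ) < m := by linarith
  have hgap := rpow_le_tangent hγ0.le hγ1.le (x := (m : ℝ) + 1) (y := m) (by linarith) hm0
  have hpow0 : 0 < (m : ℝ) ^ (γ - 1) := Real.rpow_pos_of_pos hm0 _
  have hgap' : ((m : ℝ) + 1) ^ γ - (m : ℝ) ^ γ ≤ (m : ℝ) ^ (γ - 1) := by
    nlinarith
  have hpow1 : (m : ℝ) ^ (γ - 1) ≤ 1 := Real.rpow_le_one_of_one_le_of_nonpos hmR (by linarith)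
  -- Since y < m + 1 ≤ 2m, replacing m by y/2 is allowed and costs a factor 2^(1-γ) ≤ 2.
  have hpow2 : (m : ℝ) ^ (γ - 1) ≤ 2 * x ^ (-(1 / γ - 1)) := by
    have h1 : (m : ℝ) ^ (γ - 1) ≤ (y / 2) ^ (γ - 1) :=
      Real.rpow_le_rpow_of_nonpos (by linarith) (by linarith) (by linarith)
    have h2 : y ^ (γ - 1) = x ^ (-(1 / γ - 1)) := by
      rw [hy, ← Real.rpow_mul hx0.le]; congr 1; field_simp; ring
    have h3 : (2 : ℝ) ^ (γ - 1) ≥ 1 / 2 := by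
      have := Real.rpow_le_rpow_of_exponent_le (x := 2) (by norm_num)
        (show (-1 : ℝ) ≤ γ - 1 by linarith)
      rw [Real.rpow_neg_one] at this
      linarith
    rw [Real.div_rpow (by linarith) (by norm_num), h2] at h1
    refine h1.trans ?_
    rw [div_le_iff₀ (by linarith)]
    have := Real.rpow_pos_of_pos hx0 (-(1 / γ - 1))
    nlinarith
  refine ⟨(m : ℝ) ^ γ, ⟨m, hm1, Or.inl rfl⟩, ((m : ℝ) + 1) ^ γ, ⟨m + 1, by omega, Or.inl ?_⟩,
    ?_, ?_, by linarith, by linarith⟩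
  · push_cast; rfl
  · rw [← hyx]; exact Real.rpow_le_rpow hm0.le hmy hγ0.le
  · rw [← hyx]; exact Real.rpow_le_rpow (by linarith) hym.le hγ0.le

/-- For |x| < 1 the bracket is the central hole (-1, 1); its length 2 fits the bound because
|x|^(-p) ≥ 1 there. -/
theorem exists_gammaPowers_bracket {γ : ℝ} (hγ0 : 0 < γ) (hγ1 : γ < 1) {x : ℝ} (hx : x ≠ 0) :
    ∃ u ∈ gammaPowers γ, ∃ v ∈ gammaPowers γ, u ≤ x ∧ x ≤ v ∧
      v - u ≤ 2 ∧ v - u ≤ 2 * |x| ^ (-(1 / γ - 1)) := by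
  have hp : 0 < 1 / γ - 1 := by rw [sub_pos, lt_div_iff₀ hγ0]; linarith
  rcases lt_or_ge |x| 1 with h | h
  · have h1 : 1 ≤ |x| ^ (-(1 / γ - 1)) :=
      Real.one_le_rpow_of_pos_of_le_one_of_nonpos (abs_pos.2 hx) h.le (by linarith)
    rw [abs_lt] at h
    exact ⟨-1, neg_mem_gammaPowers (one_mem_gammaPowers γ), 1, one_mem_gammaPowers γ,
      h.1.le, h.2.le, by norm_num, by linarith⟩
  · rcases le_total 0 x with h0 | h0
    · rw [abs_of_nonneg h0] at h ⊢
      exact exists_gammaPowers_bracket_of_one_le hγ0 hγ1 h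
    · rw [abs_of_nonpos h0] at h ⊢
      obtain ⟨u, hu, v, hv, hux, hxv, h2, h3⟩ := exists_gammaPowers_bracket_of_one_le hγ0 hγ1 h
      exact ⟨-v, neg_mem_gammaPowers hv, -u, neg_mem_gammaPowers hu, by linarith, by linarith,
        by linarith, by linarith⟩

theorem Ico_length_le_of_inter_gammaPowers_eq_empty {γ : ℝ} (hγ0 : 0 < γ) (hγ1 : γ < 1) {c d x : ℝ}
    (hx : x ≠ 0) (hxI : x ∈ Ico c d) (hI : Ico c d ∩ gammaPowers γ = ∅) :
    d - c ≤ 2 * |x| ^ (-(1 / γ - 1)) := by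
  obtain ⟨u, hu, v, hv, hux, hxv, -, h⟩ := exists_gammaPowers_bracket hγ0 hγ1 hx
  have hfree : ∀ z ∈ gammaPowers γ, z ∉ Ico c d := fun z hz hzI => by
    have : z ∈ Ico c d ∩ gammaPowers γ := ⟨hzI, hz⟩
    simp [hI] at this
  have h1 : u < c := by
    by_contra! hc
    exact hfree u hu ⟨hc, hux.trans_lt hxI.2⟩
  have h2 : d ≤ v := by
    by_contra! hd
    exact hfree v hv ⟨hxI.1.trans hxv, hd⟩
  linarith

theorem infDist_gammaPowers_le {γ : ℝ} (hγ0 : 0 < γ) (hγ1 : γ < 1) {x : ℝ} (hx : x ≠ 0) :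
    Metric.infDist x (gammaPowers γ) ≤ |x| ^ (-(1 / γ - 1)) := by
  obtain ⟨u, hu, v, hv, hux, hxv, -, h⟩ := exists_gammaPowers_bracket hγ0 hγ1 hx
  have h1 := Metric.infDist_le_dist_of_mem (x := x) hu
  have h2 := Metric.infDist_le_dist_of_mem (x := x) hv
  rw [Real.dist_eq, abs_of_nonneg (by linarith)] at h1
  rw [Real.dist_eq, abs_of_nonpos (by linarith)] at h2
  linarith

theorem infDist_gammaPowers_le_one {γ : ℝ} (hγ0 : 0 < γ) (hγ1 : γ < 1) (x : ℝ) :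
    Metric.infDist x (gammaPowers γ) ≤ 1 := by
  rcases eq_or_ne x 0 with rfl | hx
  · simpa using Metric.infDist_le_dist_of_mem (x := (0 : ℝ)) (one_mem_gammaPowers γ)
  obtain ⟨u, hu, v, hv, hux, hxv, h, -⟩ := exists_gammaPowers_bracket hγ0 hγ1 hx
  have h1 := Metric.infDist_le_dist_of_mem (x := x) hu
  have h2 := Metric.infDist_le_dist_of_mem (x := x) hv
  rw [Real.dist_eq, abs_of_nonneg (by linarith)] at h1
  rw [Real.dist_eq, abs_of_nonpos (by linarith)] at h2
  linarith

theorem exists_finset_card_le_of_sub_le {A : Set ℕ} {K : ℝ} (hK : 0 ≤ K)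
    (hA : ∀ m ∈ A, ∀ n ∈ A, (n : ℝ) - m ≤ K) :
    ∃ F : Finset ℕ, A ⊆ F ∧ (F.card : ℝ) ≤ K + 1 := by
  rcases A.eq_empty_or_nonempty with rfl | hne
  · exact ⟨∅, by simp, by simpa using by linarith⟩
  · have hmem := Nat.sInf_mem hne
    refine ⟨Finset.Icc (sInf A) (sInf A + ⌊K⌋₊), fun n hn => ?_, ?_⟩
    · rw [Finset.coe_Icc, mem_Icc]
      have hle := Nat.sInf_le hn
      refine ⟨hle, ?_⟩
      have h := hA _ hmem _ hn
      rw [← Nat.cast_sub hle] at h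
      have := Nat.le_floor h
      omega
    · rw [Nat.card_Icc]
      have h1 : sInf A + ⌊K⌋₊ + 1 - sInf A = ⌊K⌋₊ + 1 := by omega
      rw [h1]
      push_cast
      linarith [Nat.floor_le hK]

/-- If m^γ and n^γ lie in the interval, the tangent at n gives n - m ≤ (d - c) n^(1-γ)/γ, and
n^(1-γ) = (n^γ)^p ≤ R^p. The factor 2 accounts for the two signs. -/
theorem exists_finset_gammaPowers_inter_Icc {γ : ℝ} (hγ0 : 0 < γ) (hγ1 : γ < 1) {c d R : ℝ}
    (hcd : c ≤ d) (hR : 0 ≤ R) (hc : -R ≤ c) (hd : d ≤ R) :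
    ∃ F : Finset ℝ, gammaPowers γ ∩ Icc c d ⊆ F ∧
      (F.card : ℝ) ≤ 2 * ((d - c) * R ^ (1 / γ - 1) / γ + 1) := by
  have key : ∀ c d : ℝ, c ≤ d → d ≤ R → ∃ F : Finset ℕ,
      {m : ℕ | 1 ≤ m ∧ (m : ℝ) ^ γ ∈ Icc c d} ⊆ F ∧
        (F.card : ℝ) ≤ (d - c) * R ^ (1 / γ - 1) / γ + 1 := by
    intro c d hcd hd
    have hdc : 0 ≤ d - c := by linarith
    have hp : 0 ≤ 1 / γ - 1 := by rw [sub_nonneg, le_div_iff₀ hγ0]; linarith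
    apply exists_finset_card_le_of_sub_le
    · have := Real.rpow_nonneg hR (1 / γ - 1)
      positivity
    · rintro m ⟨hm, hmc, -⟩ n ⟨hn, -, hnd⟩
      have hm0 : (0 : ℝ) < m := by exact_mod_cast hm
      have hn0 : (0 : ℝ) < n := by exact_mod_cast hn
      have ht := rpow_le_tangent hγ0.le hγ1.le hm0.le hn0
      have hnp : ((n : ℝ) ^ (γ - 1))⁻¹ ≤ R ^ (1 / γ - 1) := by
        rw [← Real.rpow_neg hn0.le]
        have : (n : ℝ) ^ (-(γ - 1)) = ((n : ℝ) ^ γ) ^ (1 / γ - 1) := by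
          rw [← Real.rpow_mul hn0.le]; congr 1; field_simp; ring
        rw [this]
        exact Real.rpow_le_rpow (Real.rpow_nonneg hn0.le _) (hnd.trans hd) hp
      have hpos : 0 < (n : ℝ) ^ (γ - 1) := Real.rpow_pos_of_pos hn0 _
      calc (n : ℝ) - m ≤ (d - c) * ((n : ℝ) ^ (γ - 1))⁻¹ / γ := by
            rw [← div_eq_mul_inv, div_div, le_div_iff₀ (by positivity)]
            nlinarith
        _ ≤ _ := by gcongr
  obtain ⟨F₁, hF₁, hc₁⟩ := key c d hcd hd
  obtain ⟨F₂, hF₂, hc₂⟩ := key (-d) (-c) (by linarith) (by linarith)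
  classical
  refine ⟨F₁.image (fun m : ℕ => (m : ℝ) ^ γ) ∪ F₂.image (fun m : ℕ => -(m : ℝ) ^ γ), ?_, ?_⟩
  · rintro x ⟨⟨m, hm, rfl | rfl⟩, hx⟩
    · rw [Finset.mem_coe, Finset.mem_union]
      exact Or.inl (Finset.mem_image_of_mem _ (hF₁ ⟨hm, hx⟩))
    · rw [Finset.mem_coe, Finset.mem_union]
      exact Or.inr (Finset.mem_image_of_mem (fun m : ℕ => -(m : ℝ) ^ γ)
        (hF₂ ⟨hm, by linarith [hx.2], by linarith [hx.1]⟩))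
  · have h1 : ((F₁.image (fun m : ℕ => (m : ℝ) ^ γ) ∪
        F₂.image (fun m : ℕ => -(m : ℝ) ^ γ)).card : ℝ) ≤ F₁.card + F₂.card := by
      exact_mod_cast (Finset.card_union_le _ _).trans
        (add_le_add Finset.card_image_le Finset.card_image_le)
    have h2 : -c - -d = d - c := by ring
    rw [h2] at hc₂
    linarith

end GammaPowers

/-! ### Median porosity and failure of weak porosity. -/

section Porosity

theorem one_div_sub_one_pos {γ : ℝ} (hγ0 : 0 < γ) (hγ1 : γ < 1) : 0 < 1 / γ - 1 := by
  rw [sub_pos, lt_div_iff₀ hγ0]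
  linarith

theorem le_ofReal_of_isFreeDyadic_gammaPowers {γ : ℝ} (hγ0 : 0 < γ) (hγ1 : γ < 1) {a b : ℝ}
    {δ : ℝ≥0∞} {Q : Set ℝ} (hQ : IsFreeDyadic (gammaPowers γ) a b δ Q) {x : ℝ} (hxQ : x ∈ Q)
    (hx : x ≠ 0) : δ ≤ ENNReal.ofReal (2 * |x| ^ (-(1 / γ - 1))) := by
  obtain ⟨⟨j, i, -, rfl⟩, hfree, hδ⟩ := hQ
  refine hδ.trans ?_
  rw [Real.volume_Ico]
  exact ENNReal.ofReal_le_ofReal (Ico_length_le_of_inter_gammaPowers_eq_empty hγ0 hγ1 hx hxQ hfree)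

theorem medianHole_le {E : Set ℝ} {s a b : ℝ} {U : ℝ≥0∞}
    (h : ∀ δ, U < δ → freeMass E a b δ < ENNReal.ofReal (1 - s) * volume (Ico a b)) :
    medianHole E s a b ≤ U := by
  refine sSup_le fun δ hδ => ?_
  by_contra! hlt
  exact (h δ hlt).not_ge hδ.2

theorem max_abs_pos {a b : ℝ} (hab : a < b) : 0 < max |a| |b| := by
  rcases eq_or_ne a 0 with rfl | h
  · exact lt_max_of_lt_right (abs_pos.2 hab.ne')
  · exact lt_max_of_lt_left (abs_pos.2 h)

theorem max_sub_length_le_abs {a b x : ℝ} (hx : x ∈ Ico a b) :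
    max |a| |b| - (b - a) ≤ |x| := by
  obtain ⟨h1, h2⟩ := hx
  rcases max_cases |a| |b| with ⟨h, -⟩ | ⟨h, -⟩ <;> rw [h]
  · have := abs_sub_abs_le_abs_sub a x
    rw [abs_of_nonpos (by linarith : a - x ≤ 0)] at this
    linarith
  · have := abs_sub_abs_le_abs_sub b x
    rw [abs_of_nonneg (by linarith : 0 ≤ b - x)] at this
    linarith

/-- With M = max(|a|, |b|): if b - a ≥ M/2, the central interval has length M/8 ≤ (b - a)/4;
otherwise [a, b) stays in |x| > M/2 and misses it. -/
theorem volume_Icc_inter_Ico_lt {a b : ℝ} (hab : a < b) :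
    volume (Icc (-(max |a| |b| / 16)) (max |a| |b| / 16) ∩ Ico a b) <
      ENNReal.ofReal (1 - 1 / 2) * volume (Ico a b) := by
  have hM := max_abs_pos hab
  have hW : 0 < b - a := sub_pos.2 hab
  rw [Real.volume_Ico, ← ENNReal.ofReal_mul (by norm_num)]
  rcases le_or_gt (max |a| |b| / 2) (b - a) with h | h
  · refine (measure_mono inter_subset_left).trans_lt ?_
    rw [Real.volume_Icc, ENNReal.ofReal_lt_ofReal_iff (by linarith)]
    linarith
  · have hempty : Icc (-(max |a| |b| / 16)) (max |a| |b| / 16) ∩ Ico a b = ∅ := by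
      rw [eq_empty_iff_forall_notMem]
      rintro x ⟨hx1, hx2⟩
      have h1 := max_sub_length_le_abs hx2
      have h2 : |x| ≤ max |a| |b| / 16 := abs_le.2 hx1
      linarith
    rw [hempty, measure_empty, ENNReal.ofReal_pos]
    linarith

/-- Free intervals longer than the bound must lie in |x| ≤ M/16, which is less than half of [a, b).
-/
theorem medianHole_gammaPowers_le {γ : ℝ} (hγ0 : 0 < γ) (hγ1 : γ < 1) {a b : ℝ} (hab : a < b) :
    medianHole (gammaPowers γ) (1 / 2) a b ≤
      ENNReal.ofReal (2 * (max |a| |b| / 16) ^ (-(1 / γ - 1))) := by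
  have hM := max_abs_pos hab
  have hp := one_div_sub_one_pos hγ0 hγ1
  refine medianHole_le fun δ hδ => (freeMass_le_of_subset hab fun Q hQ x hx => ?_).trans_lt
    (volume_Icc_inter_Ico_lt hab)
  refine ⟨abs_le.1 ?_, subset_Ico_of_mem_dyadicSubintervals hab hQ.1 hx⟩
  by_contra! hlt
  have hx0 : x ≠ 0 := abs_pos.1 (lt_trans (by positivity) hlt)
  refine hδ.not_ge ((le_ofReal_of_isFreeDyadic_gammaPowers hγ0 hγ1 hQ hx hx0).trans ?_)
  apply ENNReal.ofReal_le_ofReal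
  have := Real.rpow_le_rpow_of_nonpos (by positivity) hlt.le (by linarith : -(1 / γ - 1) ≤ 0)
  linarith

theorem medianHole_le_volume {E : Set ℝ} {s a b : ℝ} (hs : s < 1) (hab : a < b) :
    medianHole E s a b ≤ ENNReal.ofReal (b - a) := by
  refine medianHole_le fun δ hδ => ?_
  have h0 : freeMass E a b δ ≤ volume (∅ : Set ℝ) := by
    refine freeMass_le_of_subset hab fun Q hQ => (hδ.not_ge ?_).elim
    rw [← Real.volume_Ico]
    exact hQ.2.2.trans (measure_mono (subset_Ico_of_mem_dyadicSubintervals hab hQ.1))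
  refine h0.trans_lt ?_
  rw [measure_empty, Real.volume_Ico, ← ENNReal.ofReal_mul (by linarith), ENNReal.ofReal_pos]
  exact mul_pos (by linarith) (by linarith)

theorem isMedianPorous_gammaPowers {γ : ℝ} (hγ0 : 0 < γ) (hγ1 : γ < 1) :
    IsMedianPorous (gammaPowers γ) := by
  have hp := one_div_sub_one_pos hγ0 hγ1
  set p := 1 / γ - 1 with hp_def
  have hA : (0 : ℝ) < 2 * 16 ^ p / γ := by positivity
  set A : ℝ := 2 * 16 ^ p / γ with hA_def
  -- A is the product of the point density M^p/γ and the median hole bound 2(M/16)^(-p). The 32 is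
  -- 16 · 2, from 2^(k+1) ≤ 16N and N · min(...) ≤ 2(b - a)(A + 1) below.
  refine ⟨1 / 4, 1 / 2, 1 / (32 * (A + 1)), by norm_num, by norm_num, by norm_num, by positivity,
    ?_, fun a b hab _ => ?_⟩
  · rw [div_lt_one (by positivity)]
    linarith
  have hW : 0 < b - a := sub_pos.2 hab
  have hM := max_abs_pos hab
  set M := max |a| |b| with hM_def
  obtain ⟨F, hF, hcard⟩ := exists_finset_gammaPowers_inter_Icc hγ0 hγ1 hab.le hM.le
    (by linarith [neg_abs_le a, le_max_left |a| |b|])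
    (by linarith [le_abs_self b, le_max_right |a| |b|])
  rw [← hp_def] at hcard
  have hMp : 0 < M ^ p := Real.rpow_pos_of_pos hM p
  have hquot : 0 ≤ (b - a) * M ^ p / γ := by positivity
  obtain ⟨N, hN_def⟩ : ∃ N, N = 2 * ((b - a) * M ^ p / γ + 1) := ⟨_, rfl⟩
  have hN : 2 ≤ N := by linarith
  rw [← hN_def] at hcard
  -- Generation k + 1 is fine enough that the neighbourhoods of at most N points cover at most a
  -- quarter of [a, b), yet coarse enough to exceed δ times the median hole.
  obtain ⟨k, hk1, hk2⟩ := exists_nat_pow_near (x := 8 * N) (y := 2) (by linarith) (by norm_num)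
  have hδ : ENNReal.ofReal (1 / (32 * (A + 1))) * medianHole (gammaPowers γ) (1 / 2) a b ≤
      ENNReal.ofReal ((b - a) / 2 ^ (k + 1)) := by
    have hmin : medianHole (gammaPowers γ) (1 / 2) a b ≤
        ENNReal.ofReal (min (b - a) (2 * (M / 16) ^ (-p))) := by
      rw [ENNReal.ofReal_min]
      exact le_min (medianHole_le_volume (by norm_num) hab) (medianHole_gammaPowers_le hγ0 hγ1 hab)
    refine (mul_le_mul_right hmin _).trans ?_
    rw [← ENNReal.ofReal_mul (by positivity)]
    apply ENNReal.ofReal_le_ofReal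
    have hNW : N * min (b - a) (2 * (M / 16) ^ (-p)) ≤ 2 * (b - a) * (A + 1) := by
      have h1 := min_le_left (b - a) (2 * (M / 16) ^ (-p))
      have h2 := min_le_right (b - a) (2 * (M / 16) ^ (-p))
      have h3 : (b - a) * M ^ p / γ * (2 * (M / 16) ^ (-p)) = (b - a) * A := by
        rw [Real.rpow_neg (by positivity), Real.div_rpow hM.le (by norm_num), hA_def]
        field_simp
      have h4 := mul_le_mul_of_nonneg_left h2 hquot
      rw [hN_def]
      linarith
    rw [le_div_iff₀ (by positivity), div_mul_eq_mul_div, div_mul_eq_mul_div,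
      div_le_iff₀ (by positivity), one_mul, pow_succ]
    have h0 : 0 ≤ min (b - a) (2 * (M / 16) ^ (-p)) := by positivity
    have := mul_le_mul_of_nonneg_left hk1 h0
    linarith
  have hmain := volume_le_freeMass_add hab hδ
    ((inter_subset_inter_right _ Ico_subset_Icc_self).trans hF)
  have hsmall : 2 * ((b - a) / 2 ^ (k + 1)) * F.card ≤ (b - a) / 4 := by
    rw [mul_div_assoc', div_mul_eq_mul_div, div_le_iff₀ (by positivity)]
    have := mul_le_mul_of_nonneg_left (hcard.trans (by linarith : N ≤ 2 ^ (k + 1) / 8)) hW.le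
    linarith
  have hle := hmain.trans (add_le_add_right (ENNReal.ofReal_le_ofReal hsmall) _)
  rw [Real.volume_Ico] at hle ⊢
  rw [← ENNReal.ofReal_mul (by norm_num),
    show (1 - 1 / 4) * (b - a) = (b - a) - (b - a) / 4 by ring,
    ENNReal.ofReal_sub _ (by positivity)]
  exact tsub_le_iff_right.2 hle

theorem one_le_maximalHole_gammaPowers {γ : ℝ} (hγ0 : 0 < γ) (k : ℕ) :
    1 ≤ maximalHole (gammaPowers γ) 0 (2 ^ k) := by
  refine le_sSup ⟨Ico 0 1, ⟨k, 0, by positivity, ?_⟩, ?_, by simp⟩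
  · simp
  · rw [eq_empty_iff_forall_notMem]
    rintro x ⟨⟨hx0, hx1⟩, m, hm, rfl | rfl⟩ <;>
    have h1 : 1 ≤ (m : ℝ) ^ γ := Real.one_le_rpow (by exact_mod_cast hm) hγ0.le <;> linarith

theorem not_isWeaklyPorous_gammaPowers {γ : ℝ} (hγ0 : 0 < γ) (hγ1 : γ < 1) :
    ¬ IsWeaklyPorous (gammaPowers γ) := by
  rintro ⟨s, δ, hs0, hs1, hδ0, hδ1, h⟩
  have hp := one_div_sub_one_pos hγ0 hγ1
  set p := 1 / γ - 1 with hp_def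
  -- Solves 2R^(-p) = δ: beyond R every gap is shorter than δ.
  set R : ℝ := (2 / δ) ^ p⁻¹ with hR
  have hR0 : 0 ≤ R := by positivity
  obtain ⟨k, hk⟩ := pow_unbounded_of_one_lt (2 * R / (1 - s)) (one_lt_two (α := ℝ))
  -- The exponent k + 1 guarantees that 1 belongs to the interval; [0, 2^0) would miss E.
  have hk' : 2 * R / (1 - s) < 2 ^ (k + 1) :=
    hk.trans_le (pow_le_pow_right₀ one_le_two (Nat.le_succ k))
  have hone : (1 : ℝ) < 2 ^ (k + 1) := one_lt_pow₀ one_lt_two (by omega)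
  have hpos : (0 : ℝ) < 2 ^ (k + 1) := by positivity
  have hle := (h 0 (2 ^ (k + 1)) hpos
    ⟨1, ⟨zero_le_one, hone⟩, one_mem_gammaPowers γ⟩).trans
    (freeMass_le_of_subset (S := Icc (-R) R) hpos fun Q hQ x hx => ?_)
  · rw [Real.volume_Ico, Real.volume_Icc, ← ENNReal.ofReal_mul (by linarith),
      ENNReal.ofReal_le_ofReal_iff (by linarith)] at hle
    rw [div_lt_iff₀ (by linarith)] at hk'
    linarith
  · refine abs_le.1 ?_
    rcases eq_or_ne x 0 with rfl | hx0
    · simpa using hR0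
    have h1 := le_ofReal_of_isFreeDyadic_gammaPowers hγ0 hγ1 hQ hx hx0
    have h2 : ENNReal.ofReal δ ≤ ENNReal.ofReal δ * maximalHole (gammaPowers γ) 0 (2 ^ (k + 1)) :=
      le_mul_of_one_le_right' (one_le_maximalHole_gammaPowers hγ0 _)
    have habs := abs_pos.2 hx0
    have h3 := h2.trans h1
    rw [ENNReal.ofReal_le_ofReal_iff (by positivity), Real.rpow_neg habs.le, ← div_eq_mul_inv,
      le_div_iff₀ (Real.rpow_pos_of_pos habs _), ← hp_def] at h3
    rw [hR, Real.le_rpow_inv_iff_of_pos habs.le (by positivity) hp, le_div_iff₀ hδ0]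
    linarith

end Porosity

/-! ### Truncated logarithmic singularities. -/

section LogExcess

/-- The positive part of `log (L / |u|)`. -/
noncomputable def logExcess (L u : ℝ) : ℝ := max 0 (Real.log L - Real.log u)

theorem logExcess_nonneg (L u : ℝ) : 0 ≤ logExcess L u := le_max_left _ _

theorem logExcess_abs (L u : ℝ) : logExcess L |u| = logExcess L u := by
  rw [logExcess, logExcess, Real.log_abs]

theorem logExcess_eq_zero {L u : ℝ} (hL : 0 < L) (h : L ≤ u) : logExcess L u = 0 :=
  max_eq_left (sub_nonpos.2 (Real.log_le_log hL h))

@[fun_prop]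
theorem measurable_logExcess (L : ℝ) : Measurable (logExcess L) := by
  unfold logExcess
  fun_prop

theorem logExcess_ae_eq_indicator {L : ℝ} (hL : 0 < L) :
    logExcess L =ᵐ[volume] (Ioc (-L) L).indicator fun u => Real.log L - Real.log u := by
  -- At u = 0 the convention `Real.log 0 = 0` makes the two sides differ when L < 1.
  have hc : ({0, -L} : Set ℝ).Countable := (Set.toFinite _).countable
  filter_upwards [hc.ae_notMem volume] with u hu
  simp only [mem_insert_iff, mem_singleton_iff, not_or] at hu
  by_cases hmem : u ∈ Ioc (-L) L
  · rw [indicator_of_mem hmem, logExcess, max_eq_right]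
    rw [sub_nonneg, ← Real.log_abs u]
    exact Real.log_le_log (abs_pos.2 hu.1) (abs_le.2 ⟨hmem.1.le, hmem.2⟩)
  · rw [indicator_of_notMem hmem, ← logExcess_abs]
    apply logExcess_eq_zero hL
    by_contra! hlt
    exact hmem ⟨(abs_lt.1 hlt).1, (abs_lt.1 hlt).2.le⟩

theorem integrable_logExcess {L : ℝ} (hL : 0 < L) : Integrable (logExcess L) := by
  rw [integrable_congr (logExcess_ae_eq_indicator hL), integrable_indicator_iff measurableSet_Ioc,
    ← intervalIntegrable_iff_integrableOn_Ioc_of_le (by linarith)]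
  exact intervalIntegrable_const.sub intervalIntegral.intervalIntegrable_log'

theorem integral_logExcess {L : ℝ} (hL : 0 < L) : ∫ u, logExcess L u = 2 * L := by
  rw [integral_congr_ae (logExcess_ae_eq_indicator hL), integral_indicator measurableSet_Ioc,
    ← intervalIntegral.integral_of_le (by linarith), intervalIntegral.integral_sub
      intervalIntegrable_const intervalIntegral.intervalIntegrable_log',
    intervalIntegral.integral_const, integral_log, Real.log_neg_eq_log, smul_eq_mul]
  ring

theorem setIntegral_logExcess_le {L : ℝ} (hL : 0 < L) (S : Set ℝ) :
    ∫ u in S, logExcess L u ≤ 2 * L := by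
  rw [← integral_logExcess hL]
  exact setIntegral_le_integral (integrable_logExcess hL)
    (Filter.Eventually.of_forall (logExcess_nonneg L))

/-- A nearest point of E is either at distance at least L, where the excess vanishes, or belongs to
F and contributes one term of a nonnegative sum. -/
theorem logExcess_infDist_le_sum {E : Set ℝ} (hE : IsClosed E) (hne : E.Nonempty) {a b L : ℝ}
    (hL : 0 < L) {F : Finset ℝ} (hF : E ∩ Icc (a - L) (b + L) ⊆ F) {x : ℝ} (hx : x ∈ Ico a b) :
    logExcess L (Metric.infDist x E) ≤ ∑ e ∈ F, logExcess L (x - e) := by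
  obtain ⟨e, heE, he⟩ := hE.exists_infDist_eq_dist hne x
  rw [he, Real.dist_eq]
  rcases le_or_gt L |x - e| with h | h
  · rw [logExcess_eq_zero hL h]
    exact Finset.sum_nonneg fun e _ => logExcess_nonneg L _
  · rw [logExcess_abs]
    rw [abs_lt] at h
    have heF : e ∈ F := hF ⟨heE, by linarith [hx.1], by linarith [hx.2]⟩
    exact Finset.single_le_sum (f := fun e => logExcess L (x - e))
      (fun e _ => logExcess_nonneg L _) heF

theorem integrable_sum_logExcess {L : ℝ} (hL : 0 < L) (F : Finset ℝ) :
    Integrable fun x => ∑ e ∈ F, logExcess L (x - e) :=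
  integrable_finsetSum _ fun e _ => (integrable_logExcess hL).comp_sub_right e

theorem integral_sum_logExcess {L : ℝ} (hL : 0 < L) (F : Finset ℝ) :
    ∫ x, ∑ e ∈ F, logExcess L (x - e) = 2 * L * F.card := by
  rw [integral_finsetSum _ fun e _ => (integrable_logExcess hL).comp_sub_right e]
  simp_rw [integral_sub_right_eq_self (logExcess L), integral_logExcess hL]
  rw [Finset.sum_const, nsmul_eq_mul, mul_comm]

theorem measurable_logExcess_infDist (E : Set ℝ) (L : ℝ) :
    Measurable fun x => logExcess L (Metric.infDist x E) :=
  (measurable_logExcess L).comp (Metric.continuous_infDist_pt E).measurable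

theorem integrableOn_logExcess_infDist {E : Set ℝ} (hE : IsClosed E) (hne : E.Nonempty) {a b L : ℝ}
    (hL : 0 < L) {F : Finset ℝ} (hF : E ∩ Icc (a - L) (b + L) ⊆ F) :
    IntegrableOn (fun x => logExcess L (Metric.infDist x E)) (Ico a b) := by
  refine (integrable_sum_logExcess hL F).integrableOn.mono'
    (measurable_logExcess_infDist E L).aestronglyMeasurable ?_
  filter_upwards [ae_restrict_mem measurableSet_Ico] with x hx
  rw [Real.norm_of_nonneg (logExcess_nonneg _ _)]
  exact logExcess_infDist_le_sum hE hne hL hF hx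

theorem setIntegral_logExcess_infDist_le {E : Set ℝ} (hE : IsClosed E) (hne : E.Nonempty)
    {a b L : ℝ} (hL : 0 < L) {F : Finset ℝ} (hF : E ∩ Icc (a - L) (b + L) ⊆ F) :
    ∫ x in Ico a b, logExcess L (Metric.infDist x E) ≤ 2 * L * F.card := by
  calc ∫ x in Ico a b, logExcess L (Metric.infDist x E)
      ≤ ∫ x in Ico a b, ∑ e ∈ F, logExcess L (x - e) :=
        setIntegral_mono_on (integrableOn_logExcess_infDist hE hne hL hF)
          (integrable_sum_logExcess hL F).integrableOn measurableSet_Ico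
          fun x hx => logExcess_infDist_le_sum hE hne hL hF hx
    _ ≤ ∫ x, ∑ e ∈ F, logExcess L (x - e) :=
        setIntegral_le_integral (integrable_sum_logExcess hL F)
          (Filter.Eventually.of_forall fun x => Finset.sum_nonneg fun e _ => logExcess_nonneg L _)
    _ = 2 * L * F.card := integral_sum_logExcess hL F

end LogExcess

/-! ### Mean oscillation around an arbitrary constant. -/

section MeanOscillation

theorem setAverage_Ico_eq {a b : ℝ} (hab : a < b) (f : ℝ → ℝ) :
    ⨍ x in Ico a b, f x = (b - a)⁻¹ * ∫ x in Ico a b, f x := by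
  rw [setAverage_eq, Real.volume_real_Ico_of_le hab.le, smul_eq_mul]

/-- In the mean oscillation, the average may be replaced by any constant, at the price of a
factor `2`. -/
theorem mean_oscillation_le {f : ℝ → ℝ} {a b c K : ℝ} (hab : a < b)
    (hf : IntegrableOn f (Ico a b)) (h : ∫ x in Ico a b, |f x - c| ≤ K * (b - a)) :
    ⨍ x in Ico a b, |f x - ⨍ y in Ico a b, f y| ≤ 2 * K := by
  have hW : 0 < b - a := sub_pos.2 hab
  have hconst : ∀ r : ℝ, IntegrableOn (fun _ => r) (Ico a b) := fun r =>
    integrableOn_const (by simp)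
  have hint : ∀ r : ℝ, ∫ _ in Ico a b, r = (b - a) * r := fun r => by
    rw [setIntegral_const, Real.volume_real_Ico_of_le hab.le, smul_eq_mul]
  obtain ⟨m, hm⟩ : ∃ m, m = ⨍ y in Ico a b, f y := ⟨_, rfl⟩
  rw [← hm]
  have hmI : (b - a) * m = ∫ x in Ico a b, f x := by
    rw [hm, setAverage_Ico_eq hab, mul_inv_cancel_left₀ hW.ne']
  have hcm : (b - a) * |c - m| ≤ K * (b - a) := by
    calc (b - a) * |c - m| = |∫ x in Ico a b, (f x - c)| := by
          rw [integral_sub hf (hconst c), hint, ← hmI, ← mul_sub, abs_mul, abs_of_pos hW,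
            abs_sub_comm]
      _ ≤ ∫ x in Ico a b, |f x - c| := abs_integral_le_integral_abs
      _ ≤ _ := h
  have hsum : ∫ x in Ico a b, |f x - m| ≤ ∫ x in Ico a b, (|f x - c| + |c - m|) :=
    integral_mono (hf.sub (hconst m)).abs ((hf.sub (hconst c)).abs.add (hconst _))
      fun x => abs_sub_le _ _ _
  have hadd : ∫ x in Ico a b, (|f x - c| + |c - m|) =
      (∫ x in Ico a b, |f x - c|) + ∫ _ in Ico a b, |c - m| :=
    integral_add (hf.sub (hconst c)).abs (hconst _)
  rw [hadd, hint] at hsum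
  rw [setAverage_Ico_eq hab, inv_mul_le_iff₀ hW]
  linarith

end MeanOscillation

/-! ### The function -log dist(·, E_γ): BMO but not BLO. -/

section LogDistance

theorem isClosed_gammaPowers {γ : ℝ} (hγ0 : 0 < γ) (hγ1 : γ < 1) : IsClosed (gammaPowers γ) := by
  refine isClosed_of_closure_subset fun x hx => ?_
  obtain ⟨F, hF, -⟩ := exists_finset_gammaPowers_inter_Icc hγ0 hγ1
    (c := x - 1) (d := x + 1) (R := |x| + 1) (by linarith) (by positivity)
    (by linarith [neg_abs_le x]) (by linarith [le_abs_self x])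
  have hfin : (gammaPowers γ ∩ Icc (x - 1) (x + 1)).Finite := F.finite_toSet.subset hF
  have hxI : x ∈ Ioo (x - 1) (x + 1) := mem_Ioo.2 ⟨by linarith, by linarith⟩
  have h1 : x ∈ closure (Ioo (x - 1) (x + 1) ∩ gammaPowers γ) :=
    isOpen_Ioo.inter_closure (mem_inter hxI hx)
  have h2 : x ∈ closure (gammaPowers γ ∩ Icc (x - 1) (x + 1)) :=
    by
    refine closure_mono ?_ h1
    rintro y ⟨hy1, hy2⟩
    exact ⟨hy2, Ioo_subset_Icc_self hy1⟩
  rw [hfin.isClosed.closure_eq] at h2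
  exact h2.1

theorem infDist_gammaPowers_pos {γ : ℝ} (hγ0 : 0 < γ) (hγ1 : γ < 1) {x : ℝ}
    (hx : x ∉ gammaPowers γ) : 0 < Metric.infDist x (gammaPowers γ) :=
  ((isClosed_gammaPowers hγ0 hγ1).notMem_iff_infDist_pos ⟨1, one_mem_gammaPowers γ⟩).1 hx

theorem neg_log_infDist_gammaPowers_eq {γ : ℝ} (hγ0 : 0 < γ) (hγ1 : γ < 1) (x : ℝ) :
    -Real.log (Metric.infDist x (gammaPowers γ)) =
      logExcess 1 (Metric.infDist x (gammaPowers γ)) := by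
  rw [logExcess, Real.log_one, zero_sub, max_eq_right]
  exact neg_nonneg.2
    (Real.log_nonpos Metric.infDist_nonneg (infDist_gammaPowers_le_one hγ0 hγ1 x))

theorem integrableOn_neg_log_infDist_gammaPowers {γ : ℝ} (hγ0 : 0 < γ) (hγ1 : γ < 1) {a b : ℝ}
    (hab : a < b) :
    IntegrableOn (fun x => -Real.log (Metric.infDist x (gammaPowers γ))) (Ico a b) := by
  obtain ⟨F, hF, -⟩ := exists_finset_gammaPowers_inter_Icc hγ0 hγ1
    (c := a - 1) (d := b + 1) (R := max |a| |b| + 1) (by linarith) (by positivity)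
    (by linarith [neg_abs_le a, le_max_left |a| |b|])
    (by linarith [le_abs_self b, le_max_right |a| |b|])
  simp_rw [neg_log_infDist_gammaPowers_eq hγ0 hγ1]
  exact integrableOn_logExcess_infDist (isClosed_gammaPowers hγ0 hγ1) ⟨1, one_mem_gammaPowers γ⟩
    one_pos hF

theorem locallyIntegrable_neg_log_infDist_gammaPowers {γ : ℝ} (hγ0 : 0 < γ) (hγ1 : γ < 1) :
    LocallyIntegrable (fun x => -Real.log (Metric.infDist x (gammaPowers γ))) volume := fun x =>
  ⟨Ico (x - 1) (x + 1), Ico_mem_nhds (by linarith) (by linarith),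
    integrableOn_neg_log_infDist_gammaPowers hγ0 hγ1 (by linarith)⟩

theorem log_infDist_gammaPowers_le {γ : ℝ} (hγ0 : 0 < γ) (hγ1 : γ < 1) {x : ℝ} (hx0 : x ≠ 0)
    (hx : x ∉ gammaPowers γ) :
    Real.log (Metric.infDist x (gammaPowers γ)) ≤ -((1 / γ - 1) * Real.log x) := by
  have h := Real.log_le_log (infDist_gammaPowers_pos hγ0 hγ1 hx)
    (infDist_gammaPowers_le hγ0 hγ1 hx0)
  rw [Real.log_rpow (abs_pos.2 hx0), Real.log_abs] at h
  linarith

theorem not_isBLO_neg_log_infDist_gammaPowers {γ : ℝ} (hγ0 : 0 < γ) (hγ1 : γ < 1) :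
    ¬ IsBLO (fun x => -Real.log (Metric.infDist x (gammaPowers γ))) := by
  rintro ⟨-, C, hC⟩
  have hp := one_div_sub_one_pos hγ0 hγ1
  obtain ⟨p, hp_def⟩ : ∃ p, p = 1 / γ - 1 := ⟨_, rfl⟩
  rw [← hp_def] at hp
  have hlog2 : 0 < Real.log 2 := Real.log_pos one_lt_two
  -- Chosen so that pT/2, a lower bound for the average over [0, 2X), exceeds C + log 2.
  obtain ⟨T, hT⟩ : ∃ T, T = 2 * (|C| + Real.log 2) / p + 1 := ⟨_, rfl⟩
  have hT0 : 0 < T := by rw [hT]; positivity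
  have hX : 1 < Real.exp T := Real.one_lt_exp_iff.2 hT0
  obtain ⟨X, hX_def⟩ : ∃ X, X = Real.exp T := ⟨_, rfl⟩
  rw [← hX_def] at hX
  have hlogX : Real.log X = T := by rw [hX_def, Real.log_exp]
  have h := hC 0 (2 * X) (by linarith)
  have hess : essInf (fun x => ((-Real.log (Metric.infDist x (gammaPowers γ)) : ℝ) : EReal))
      (volume.restrict (Ico 0 (2 * X))) ≤ ((Real.log 2 : ℝ) : EReal) := by
    refine Filter.liminf_le_of_frequently_le' ?_
    rw [frequently_ae_iff]
    refine ne_of_gt (lt_of_lt_of_le ?_ (measure_mono (s := Icc 0 (1 / 2)) fun x hx => ?_))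
    · rw [Measure.restrict_apply measurableSet_Icc,
        inter_eq_left.2 fun x hx => mem_Ico.2 ⟨hx.1, by linarith [hx.2]⟩, Real.volume_Icc]
      norm_num
    · have hd : 1 / 2 ≤ Metric.infDist x (gammaPowers γ) := by
        rw [Metric.le_infDist ⟨1, one_mem_gammaPowers γ⟩]
        rintro y ⟨m, hm, rfl | rfl⟩ <;>
        have h1 : 1 ≤ (m : ℝ) ^ γ := Real.one_le_rpow (by exact_mod_cast hm) hγ0.le <;>
        rw [Real.dist_eq, le_abs]
        · right; linarith [hx.2]
        · left; linarith [hx.1]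
      have := Real.log_le_log (by norm_num) hd
      rw [one_div, Real.log_inv] at this
      rw [mem_ofPred_eq, EReal.coe_le_coe_iff]
      linarith
  have h2 := (EReal.sub_le_sub le_rfl hess).trans h
  rw [← EReal.coe_sub, EReal.coe_le_coe_iff] at h2
  have hint := integrableOn_neg_log_infDist_gammaPowers hγ0 hγ1 (a := 0) (b := 2 * X) (by linarith)
  have hsub : Ico X (2 * X) ⊆ Ico 0 (2 * X) := Ico_subset_Ico_left (by linarith)
  -- The integrand is nonnegative, so only the right half is kept, where it is at least p log X =
  -- pT.
  have h3 : ∫ x in Ico X (2 * X), -Real.log (Metric.infDist x (gammaPowers γ)) ≤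
      ∫ x in Ico 0 (2 * X), -Real.log (Metric.infDist x (gammaPowers γ)) := by
    refine setIntegral_mono_set hint (Filter.Eventually.of_forall fun x => ?_) hsub.eventuallyLE
    simp only [Pi.zero_apply]
    rw [neg_log_infDist_gammaPowers_eq hγ0 hγ1]
    exact logExcess_nonneg _ _
  have h4 : ∫ _ in Ico X (2 * X), p * T ≤
      ∫ x in Ico X (2 * X), -Real.log (Metric.infDist x (gammaPowers γ)) := by
    refine setIntegral_mono_on_ae (integrableOn_const (by simp)) (hint.mono_set hsub)
      measurableSet_Ico ?_
    filter_upwards [(countable_gammaPowers γ).ae_notMem volume] with x hxE hx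
    have h5 := log_infDist_gammaPowers_le hγ0 hγ1 (by linarith [hx.1] : x ≠ 0) hxE
    have h6 := Real.log_le_log (by linarith) hx.1
    rw [← hp_def] at h5
    rw [hlogX] at h6
    nlinarith
  rw [setIntegral_const, Real.volume_real_Ico_of_le (by linarith), smul_eq_mul] at h4
  rw [setAverage_Ico_eq (by linarith)] at h2
  have h7 : (2 * X - 0)⁻¹ * ((2 * X - X) * (p * T)) ≤ C + Real.log 2 := by
    have := mul_le_mul_of_nonneg_left (h4.trans h3) (inv_nonneg.2 (by linarith) : 0 ≤ (2 * X - 0)⁻¹)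
    linarith
  have h8 : (2 * X - 0)⁻¹ * ((2 * X - X) * (p * T)) = p * T / 2 := by
    rw [sub_zero]; field_simp; ring
  have h9 : p * T = 2 * (|C| + Real.log 2) + p := by
    rw [hT]; field_simp
  linarith [le_abs_self C]

/-- The same dichotomy as for the median hole: a long interval pays for the whole integral 2 max(1,
M), and otherwise |x| ≥ M/2 bounds the excess by log 2. The hypothesis `h` rules out short intervals
near 0, where the mean of log(1/|x|) is unbounded. -/
theorem setIntegral_logExcess_max_abs_le {a b : ℝ} (hab : a < b)
    (h : max |a| |b| ≤ 1 → 1 ≤ b - a) :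
    ∫ x in Ico a b, logExcess (max 1 (max |a| |b|)) x ≤ 4 * (b - a) := by
  have hM := max_abs_pos hab
  set M := max |a| |b| with hM_def
  have hW : 0 < b - a := sub_pos.2 hab
  have hM1 : 0 < max 1 M := by positivity
  rcases le_or_gt (max 1 M / 2) (b - a) with h1 | h1
  · linarith [setIntegral_logExcess_le hM1 (Ico a b)]
  · have hM' : 1 < M := by
      by_contra! hle
      rw [max_eq_left hle] at h1
      linarith [h hle]
    rw [max_eq_right hM'.le] at h1 hM1 ⊢
    have hle : ∫ x in Ico a b, logExcess M x ≤ ∫ _ in Ico a b, Real.log 2 := by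
      refine setIntegral_mono_on (integrable_logExcess hM1).integrableOn
        (integrableOn_const (by simp)) measurableSet_Ico fun x hx => ?_
      have hx1 := max_sub_length_le_abs hx
      have hx2 : M / 2 ≤ |x| := by linarith
      have := Real.log_le_log (by linarith) hx2
      rw [Real.log_div hM1.ne' two_ne_zero, Real.log_abs] at this
      exact max_le (Real.log_nonneg one_le_two) (by linarith)
    rw [setIntegral_const, Real.volume_real_Ico_of_le hab.le, smul_eq_mul] at hle
    nlinarith [Real.log_two_lt_d9]

/-- The scale L is at most the order of the mesh, so L times the point density is bounded; the extra
+1 in the count costs L ≤ b - a. -/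
theorem length_scale_mul_card_le {γ : ℝ} (hγ0 : 0 < γ) (hγ1 : γ < 1) {a b L : ℝ} (hab : a < b)
    (hL : 0 < L) (hLW : L ≤ b - a) (hLM : L ≤ (max 1 (max |a| |b|)) ^ (-(1 / γ - 1))) :
    ∃ F : Finset ℝ, gammaPowers γ ∩ Icc (a - L) (b + L) ⊆ F ∧
      L * F.card ≤ 2 * (3 * 2 ^ (1 / γ - 1) / γ + 1) * (b - a) := by
  have hp := one_div_sub_one_pos hγ0 hγ1
  set p := 1 / γ - 1
  set M := max 1 (max |a| |b|) with hM_def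
  have hM1 : 1 ≤ M := le_max_left _ _
  have hM2 : max |a| |b| ≤ M := le_max_right _ _
  have hL1 : L ≤ 1 := hLM.trans (Real.rpow_le_one_of_one_le_of_nonpos hM1 (by linarith))
  have hMp : 0 < M ^ p := Real.rpow_pos_of_pos (by linarith) p
  have hLMp : L * M ^ p ≤ 1 := by
    rw [Real.rpow_neg (by linarith)] at hLM
    have := mul_le_mul_of_nonneg_right hLM hMp.le
    rwa [inv_mul_cancel₀ hMp.ne'] at this
  obtain ⟨F, hF, hcard⟩ := exists_finset_gammaPowers_inter_Icc hγ0 hγ1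
    (c := a - L) (d := b + L) (R := 2 * M) (by linarith) (by linarith)
    (by linarith [neg_abs_le a, le_max_left |a| |b|])
    (by linarith [le_abs_self b, le_max_right |a| |b|])
  refine ⟨F, hF, (mul_le_mul_of_nonneg_left hcard hL.le).trans ?_⟩
  rw [Real.mul_rpow zero_le_two (by linarith)]
  have h1 : L * (2 * ((b + L - (a - L)) * (2 ^ p * M ^ p) / γ + 1)) =
      2 * ((b - a + 2 * L) * (L * M ^ p) * (2 ^ p / γ) + L) := by ring
  have h2 : (b - a + 2 * L) * (L * M ^ p) ≤ 3 * (b - a) * 1 := by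
    apply mul_le_mul (by linarith) hLMp (by positivity) (by linarith)
  have h3 : (0 : ℝ) ≤ 2 ^ p / γ := by positivity
  have h4 := mul_le_mul_of_nonneg_right h2 h3
  rw [h1]
  calc _ ≤ 2 * (3 * (b - a) * 1 * (2 ^ p / γ) + (b - a)) := by gcongr
    _ = _ := by ring

theorem abs_neg_log_add_log_le (L d : ℝ) :
    |-Real.log d - -Real.log L| ≤ logExcess L d + max 0 (Real.log d - Real.log L) := by
  rw [logExcess]
  rcases le_total (Real.log L) (Real.log d) with h | h
  · rw [max_eq_left (by linarith), max_eq_right (by linarith), abs_of_nonpos (by linarith)]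
    linarith
  · rw [max_eq_right (by linarith), max_eq_left (by linarith), abs_of_nonneg (by linarith)]
    linarith

/-- Splits |f + log L| into the part where the distance is below L, paid for by the point count, and
the part above, majorised by `G`. -/
theorem setIntegral_abs_neg_log_infDist_le {γ : ℝ} (hγ0 : 0 < γ) (hγ1 : γ < 1) {a b L : ℝ}
    (hab : a < b) (hL : 0 < L) (hLW : L ≤ b - a)
    (hLM : L ≤ (max 1 (max |a| |b|)) ^ (-(1 / γ - 1))) {G : ℝ → ℝ}
    (hG : IntegrableOn G (Ico a b)) (hG0 : ∀ x, 0 ≤ G x)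
    (hGd : ∀ x ∈ Ico a b, x ≠ 0 → x ∉ gammaPowers γ →
      Real.log (Metric.infDist x (gammaPowers γ)) - Real.log L ≤ G x) :
    ∫ x in Ico a b, |-Real.log (Metric.infDist x (gammaPowers γ)) - -Real.log L| ≤
      4 * (3 * 2 ^ (1 / γ - 1) / γ + 1) * (b - a) + ∫ x in Ico a b, G x := by
  obtain ⟨F, hF, hcard⟩ := length_scale_mul_card_le hγ0 hγ1 hab hL hLW hLM
  have hcl := isClosed_gammaPowers hγ0 hγ1
  have hne : (gammaPowers γ).Nonempty := ⟨1, one_mem_gammaPowers γ⟩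
  have hint := integrableOn_logExcess_infDist hcl hne hL hF
  have hle := setIntegral_logExcess_infDist_le hcl hne hL hF
  have hf := integrableOn_neg_log_infDist_gammaPowers hγ0 hγ1 hab
  have hc : IntegrableOn (fun _ : ℝ => -Real.log L) (Ico a b) := integrableOn_const (by simp)
  calc ∫ x in Ico a b, |-Real.log (Metric.infDist x (gammaPowers γ)) - -Real.log L|
      ≤ ∫ x in Ico a b, (logExcess L (Metric.infDist x (gammaPowers γ)) + G x) := by
        refine setIntegral_mono_on_ae (hf.sub hc).abs (hint.add hG) measurableSet_Ico ?_
        have hcount : (insert 0 (gammaPowers γ)).Countable := (countable_gammaPowers γ).insert 0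
        filter_upwards [hcount.ae_notMem volume] with x hx hxI
        rw [mem_insert_iff, not_or] at hx
        refine (abs_neg_log_add_log_le L _).trans ?_
        gcongr
        exact max_le (hG0 x) (hGd x hxI hx.1 hx.2)
    _ = (∫ x in Ico a b, logExcess L (Metric.infDist x (gammaPowers γ))) + ∫ x in Ico a b, G x :=
        integral_add hint hG
    _ ≤ _ := by linarith

/-- With M = max(1, |a|, |b|) there are three regimes. If b - a ≥ M^(-p), take L = M^(-p) and
majorant p log⁺(M/|x|). If b - a is smaller and a is within 2(b - a) of E, take L = b - a; distances
are at most 3L and log 3 ≤ 2. Otherwise the distance varies by at most a factor 2 on [a, b), so f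
moves by at most log 2 < 1. -/
theorem isBMO_neg_log_infDist_gammaPowers {γ : ℝ} (hγ0 : 0 < γ) (hγ1 : γ < 1) :
    IsBMO (fun x => -Real.log (Metric.infDist x (gammaPowers γ))) := by
  have hp := one_div_sub_one_pos hγ0 hγ1
  obtain ⟨B, hB⟩ : ∃ B, B = 4 * (3 * 2 ^ (1 / γ - 1) / γ + 1) := ⟨_, rfl⟩
  have hB0 : 0 < B := by rw [hB]; positivity
  refine ⟨locallyIntegrable_neg_log_infDist_gammaPowers hγ0 hγ1,
    2 * (B + 4 * (1 / γ - 1) + 2), fun a b hab => ?_⟩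
  have hW : 0 < b - a := sub_pos.2 hab
  have hf := integrableOn_neg_log_infDist_gammaPowers hγ0 hγ1 hab
  have hpW : 0 < (1 / γ - 1) * (b - a) := mul_pos hp hW
  have hBW : 0 < B * (b - a) := mul_pos hB0 hW
  obtain ⟨M, hM⟩ : ∃ M, M = max 1 (max |a| |b|) := ⟨_, rfl⟩
  have hM1 : 1 ≤ M := by rw [hM]; exact le_max_left _ _
  have hM0 : 0 < M := by linarith
  have hL0 : 0 < M ^ (-(1 / γ - 1)) := Real.rpow_pos_of_pos hM0 _
  rcases le_or_gt (M ^ (-(1 / γ - 1))) (b - a) with hcase | hcase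
  · have hG : IntegrableOn (fun x => (1 / γ - 1) * logExcess M x) (Ico a b) :=
      ((integrable_logExcess hM0).const_mul _).integrableOn
    have h := setIntegral_abs_neg_log_infDist_le hγ0 hγ1 hab hL0 hcase (by rw [← hM]) hG
      (fun x => mul_nonneg hp.le (logExcess_nonneg _ _)) fun x _ hx0 hxE => ?_
    · refine mean_oscillation_le hab hf (h.trans ?_)
      have hmax := setIntegral_logExcess_max_abs_le hab fun hle => by
        rw [hM, max_eq_left hle, Real.one_rpow] at hcase
        exact hcase
      rw [integral_const_mul, ← hB]
      rw [← hM] at hmax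
      have := mul_le_mul_of_nonneg_left hmax hp.le
      linarith
    · have h1 := log_infDist_gammaPowers_le hγ0 hγ1 hx0 hxE
      rw [Real.log_rpow hM0]
      have h2 := mul_le_mul_of_nonneg_left
        (le_max_right 0 (Real.log M - Real.log x)) hp.le
      rw [logExcess]
      linarith
  · have hlip : ∀ x ∈ Ico a b, |Metric.infDist x (gammaPowers γ) -
        Metric.infDist a (gammaPowers γ)| ≤ b - a := fun x hx => by
      have h1 := Metric.infDist_le_infDist_add_dist (s := gammaPowers γ) (x := x) (y := a)
      have h2 := Metric.infDist_le_infDist_add_dist (s := gammaPowers γ) (x := a) (y := x)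
      rw [Real.dist_eq, abs_of_nonneg (by linarith [hx.1])] at h1
      rw [Real.dist_eq, abs_of_nonpos (by linarith [hx.1])] at h2
      rw [abs_le]
      constructor <;> linarith [hx.2]
    rcases le_or_gt (Metric.infDist a (gammaPowers γ)) (2 * (b - a)) with hd | hd
    · have h := setIntegral_abs_neg_log_infDist_le hγ0 hγ1 hab hW le_rfl
        (by rw [← hM]; exact hcase.le) (G := fun _ => 2) (integrableOn_const (by simp)) (fun _ => zero_le_two)
        fun x hx _ hxE => ?_
      · refine mean_oscillation_le hab hf (h.trans ?_)
        rw [setIntegral_const, Real.volume_real_Ico_of_le hab.le, smul_eq_mul, ← hB]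
        linarith
      · have hx3 : Metric.infDist x (gammaPowers γ) ≤ 3 * (b - a) := by
          linarith [(abs_le.1 (hlip x hx)).2]
        have h1 := Real.log_le_log (infDist_gammaPowers_pos hγ0 hγ1 hxE) hx3
        rw [Real.log_mul (by norm_num) hW.ne'] at h1
        have h2 := Real.log_le_sub_one_of_pos (zero_lt_three (α := ℝ))
        linarith
    · refine mean_oscillation_le (c := -Real.log (Metric.infDist a (gammaPowers γ))) hab hf ?_
      obtain ⟨d₀, hd₀⟩ : ∃ d₀, d₀ = Metric.infDist a (gammaPowers γ) := ⟨_, rfl⟩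
      rw [← hd₀] at hd hlip ⊢
      have hd0 : 0 < d₀ := by linarith
      have hc : ∀ r : ℝ, IntegrableOn (fun _ : ℝ => r) (Ico a b) := fun r =>
        integrableOn_const (by simp)
      have hle : ∫ x in Ico a b, |-Real.log (Metric.infDist x (gammaPowers γ)) - -Real.log d₀| ≤
          ∫ _ in Ico a b, (1 : ℝ) := by
        refine setIntegral_mono_on (hf.sub (hc _)).abs (hc 1) measurableSet_Ico fun x hx => ?_
        obtain ⟨h1, h2⟩ := abs_le.1 (hlip x hx)
        have h3 := Real.log_le_log (by linarith)
          (by linarith : Metric.infDist x (gammaPowers γ) ≤ 2 * d₀)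
        have h4 := Real.log_le_log (by linarith)
          (by linarith : d₀ / 2 ≤ Metric.infDist x (gammaPowers γ))
        rw [Real.log_mul two_ne_zero hd0.ne'] at h3
        rw [Real.log_div hd0.ne' two_ne_zero] at h4
        have h5 := Real.log_two_lt_d9
        rw [abs_le]
        constructor <;> linarith
      rw [setIntegral_const, Real.volume_real_Ico_of_le hab.le, smul_eq_mul] at hle
      linarith

end LogDistance

theorem theorem9p1 (γ : ℝ) (hγ0 : 0 < γ) (hγ1 : γ < 1) :
    IsMedianPorous (gammaPowers γ) ∧
      ¬ IsWeaklyPorous (gammaPowers γ) ∧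
      IsBMO (fun x => -Real.log (Metric.infDist x (gammaPowers γ))) ∧
      ¬ IsBLO (fun x => -Real.log (Metric.infDist x (gammaPowers γ))) :=
  ⟨isMedianPorous_gammaPowers hγ0 hγ1, not_isWeaklyPorous_gammaPowers hγ0 hγ1,
    isBMO_neg_log_infDist_gammaPowers hγ0 hγ1, not_isBLO_neg_log_infDist_gammaPowers hγ0 hγ1⟩
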